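/- Let $L$ be a first-order language of any cardinality. A formula is *positive* if it is built from atomic formulas (including equations) and $\bot$ using only $\exists,\wedge,\vee$. For an $L$-structure $M$, let $\mathrm{Th}^+(M)$ consist of all positive sentences true in $M$ together with the negations of all positive sentences false in $M$. A map $f\colon M\to N$ between $L$-structures is an *immersion* if for every positive formula $\varphi(v_1,\dots,v_n)$ and all $a_1,\dots,a_n\in M$ we have $M\models\varphi(a_1,\dots,a_n)$ if and only if $N\models\varphi(f(a_1),\dots,f(a_n))$. A model $M$ of a theory $T$ is a *pec* (positively existentially closed) model of $T$ if every homomorphism from $M$ to a model of $T$ is an immersion. For a cardinal $\kappa$, $M$ is *positively $\kappa$-saturated* if every set $p(x_1,\dots,x_n)$ of positive formulas in finitely many variables with fewer than $\kappa$ parameters from $M$ that is finitely satisfiable in $M$ is realized in $M$; $M$ is *positively saturated* if it is positively $|M|$-saturated. A *chain of structures* is a family of $L$-structures $\{M_x\mid x\in X\}$ indexed by a nonempty well-ordered set $X$ with homomorphisms $f_{xy}\colon M_x\to M_y$ for $x\le y$ such that $f_{xx}$ is the identity and $f_{xz}=f_{yz}\circ f_{xy}$ for $x\le y\le z$. Let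 $\mathsf{P}_{\mathrm u}(M)$ be the class of structures isomorphic to an ultrapower of $M$, and for a class $\mathsf K$ of $L$-structures let $\mathsf{L}_{\mathrm c}(\mathsf K)$ be the class of structures isomorphic to the direct limit of a chain of members of $\mathsf K$; write $\mathsf{L}_{\mathrm c}(M)$ when all members of the chain are copies of $M$. **Proposition.** For every $L$-structure $M$ there exists a positively $\omega$-saturated pec model $M_\omega$ of $\mathrm{Th}^+(M)$ such that $M_\omega\in\mathsf{L}_{\mathrm c}\mathsf{P}_{\mathrm u}(M)$. In addition, if $M$ is positively saturated and either finite or such that $|L|\le|M|$, then there exists a positively $\omega$-saturated pec model $M_\omega$ of $\mathrm{Th}^+(M)$ such that $M_\omega\in\mathsf{L}_{\mathrm c}(M)$. -/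

import Mathlib

universe u v w w'

namespace PositiveLogic

open FirstOrder.Language Cardinal
open scoped FirstOrder

/-! ### Positive formulas, positive theories, pec models -/

/-- The positive formulas: those built from atomic formulas and `⊥` using only `∧`, `∨`, `∃`. -/
inductive IsPositive {L : FirstOrder.Language.{u, v}} {α : Type w} : ∀ {n : ℕ}, L.BoundedFormula α n → Prop
  | falsum {n : ℕ} : IsPositive (⊥ : L.BoundedFormula α n)
  | atomic {n : ℕ} {φ : L.BoundedFormula α n} (h : φ.IsAtomic) : IsPositive φ
  | inf {n : ℕ} {φ ψ : L.BoundedFormula α n} (hφ : IsPositive φ) (hψ : IsPositive ψ) :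
      IsPositive (φ ⊓ ψ)
  | sup {n : ℕ} {φ ψ : L.BoundedFormula α n} (hφ : IsPositive φ) (hψ : IsPositive ψ) :
      IsPositive (φ ⊔ ψ)
  | ex {n : ℕ} {φ : L.BoundedFormula α (n + 1)} (hφ : IsPositive φ) : IsPositive φ.ex

/-- The positive theory of `M`: the positive sentences valid in `M`. -/
def positiveTheory (L : FirstOrder.Language.{u, v}) (M : Type w) [L.Structure M] : L.Theory :=
  {φ : L.Sentence | IsPositive φ ∧ M ⊨ φ}

/-- `Th⁺(M)`: the positive theory of `M` together with the negations of all positive sentences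
that fail in `M`. -/
def thPlus (L : FirstOrder.Language.{u, v}) (M : Type w) [L.Structure M] : L.Theory :=
  positiveTheory L M ∪
    {χ : L.Sentence | ∃ φ : L.Sentence, IsPositive φ ∧ ¬ M ⊨ φ ∧ χ = ∼φ}

/-- A map between structures is an immersion when it preserves and reflects all positive
formulas. -/
def IsImmersion (L : FirstOrder.Language.{u, v}) {M : Type w} {N : Type w'} [L.Structure M] [L.Structure N]
    (f : M → N) : Prop :=
  ∀ (n : ℕ) (φ : L.Formula (Fin n)), IsPositive φ →
    ∀ a : Fin n → M, φ.Realize a ↔ φ.Realize (f ∘ a)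

/-- `M` is a positively existentially closed model of `T`: it is a model of `T`, and every
homomorphism from `M` to a model of `T` is an immersion. The models `N` range over the universe
`max u v w`, which contains a copy of every structure of size at most `|M| + |L| + ℵ₀`; by the
downward Löwenheim–Skolem theorem larger universes give the same notion. -/
def IsPecModel {L : FirstOrder.Language.{u, v}} (T : L.Theory) (M : Type w) [L.Structure M] : Prop :=
  M ⊨ T ∧ ∀ (N : Type (max u v w)) [L.Structure N], N ⊨ T →
    ∀ f : M →[L] N, IsImmersion L f

/-! ### Positive saturation -/

/-- `M` is positively `κ`-saturated: for every set `A` of fewer than `κ` parameters, every set `p`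
of positive formulas in finitely many variables `x₁, …, xₙ` with parameters in `A` which is
finitely satisfiable in `M` is realized in `M`. -/
def IsPositivelySaturatedFor (L : FirstOrder.Language.{u, v}) (κ : Cardinal.{w}) (M : Type w)
    [L.Structure M] : Prop :=
  ∀ A : Set M, #A < κ → ∀ (n : ℕ) (p : Set (L.Formula (A ⊕ Fin n))), (∀ φ ∈ p, IsPositive φ) →
    (∀ q ⊆ p, q.Finite →
      ∃ b : Fin n → M, ∀ φ ∈ q, φ.Realize (Sum.elim (fun a : A => (a : M)) b)) →
    ∃ b : Fin n → M, ∀ φ ∈ p, φ.Realize (Sum.elim (fun a : A => (a : M)) b)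

/-- `M` is positively saturated when it is positively `|M|`-saturated. -/
def IsPositivelySaturated (L : FirstOrder.Language.{u, v}) (M : Type w) [L.Structure M] : Prop :=
  IsPositivelySaturatedFor L #M M

/-! ### Chains of structures and their direct limits -/

/-- A chain of structures: a family of structures indexed by a nonempty well-ordered set, with a
functorial family of homomorphisms (not necessarily embeddings). -/
structure Chain (L : FirstOrder.Language.{u, v}) where
  /-- the index set -/
  Idx : Type w'
  [linearOrder : LinearOrder Idx]
  [wellFounded : WellFoundedLT Idx]
  [nonempty : Nonempty Idx]
  /-- the structures of the chain -/
  obj : Idx → Type w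
  [struct : ∀ x, L.Structure (obj x)]
  /-- the homomorphisms of the chain -/
  map : ∀ x y, x ≤ y → obj x →[L] obj y
  map_self : ∀ x (a : obj x), map x x le_rfl a = a
  map_map : ∀ x y z (hxy : x ≤ y) (hyz : y ≤ z) (a : obj x),
    map y z hyz (map x y hxy a) = map x z (hxy.trans hyz) a

namespace Chain

attribute [instance] Chain.linearOrder Chain.wellFounded Chain.nonempty Chain.struct

variable {L : FirstOrder.Language.{u, v}} (C : Chain.{u, v, w, w'} L)

instance : DirectedSystem C.obj (fun x y h => C.map x y h) where
  map_self x a := C.map_self x a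
  map_map z y x hxy hyz a := C.map_map x y z hxy hyz a

/-- The universe of the direct limit of a chain. -/
def Limit : Type (max w w') := DirectLimit C.obj C.map

/-- The canonical map of a member of the chain to the direct limit. -/
def toLimit (x : C.Idx) (a : C.obj x) : C.Limit :=
  Quotient.mk (DirectLimit.setoid C.map) ⟨x, a⟩

theorem toLimit_map {x y : C.Idx} (h : x ≤ y) (a : C.obj x) :
    C.toLimit y (C.map x y h a) = C.toLimit x a :=
  DirectLimit.mk_apply (f := C.map) x y a h

theorem toLimit_eq_iff {x y : C.Idx} (a : C.obj x) (b : C.obj y) :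
    C.toLimit x a = C.toLimit y b ↔
      ∃ (z : C.Idx) (hx : x ≤ z) (hy : y ≤ z), C.map x z hx a = C.map y z hy b :=
  Quotient.eq (r := DirectLimit.setoid C.map)

theorem exists_toLimit (c : C.Limit) : ∃ x a, c = C.toLimit x a :=
  DirectLimit.exists_eq_mk C.map c

/-- A finite tuple of the direct limit comes from a tuple of some member of the chain. -/
theorem exists_tuple {n : ℕ} (c : Fin n → C.Limit) :
    ∃ (x : C.Idx) (a : Fin n → C.obj x), c = fun i => C.toLimit x (a i) := by
  choose y b hb using fun i => C.exists_toLimit (c i)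
  obtain ⟨x, hx⟩ := Finite.bddAbove_range y
  refine ⟨x, fun i => C.map (y i) x (hx ⟨i, rfl⟩) (b i), ?_⟩
  funext i
  rw [toLimit_map, hb]

theorem exists_map_eq {n : ℕ} {x y : C.Idx} (a : Fin n → C.obj x) (b : Fin n → C.obj y)
    (h : ∀ i, C.toLimit x (a i) = C.toLimit y (b i)) :
    ∃ (z : C.Idx) (hx : x ≤ z) (hy : y ≤ z), ∀ i, C.map x z hx (a i) = C.map y z hy (b i) := by
  choose t hxt hyt ht using fun i => (C.toLimit_eq_iff (a i) (b i)).1 (h i)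
  obtain ⟨z, hz⟩ := Finite.bddAbove_range t
  refine ⟨max z (max x y), by simp, by simp, fun i => ?_⟩
  have hi : t i ≤ max z (max x y) := (hz ⟨i, rfl⟩).trans (le_max_left _ _)
  rw [← C.map_map x (t i) _ (hxt i) hi, ← C.map_map y (t i) _ (hyt i) hi, ht i]

/-- The direct limit of a chain as a structure: a basic operation is computed in any member of the
chain from which the arguments come, and a basic relation holds when it holds in some such
member. -/
noncomputable instance limitStructure : L.Structure C.Limit where
  funMap F c := C.toLimit (C.exists_tuple c).choose
    (Structure.funMap F (C.exists_tuple c).choose_spec.choose)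
  RelMap R c := ∃ (x : C.Idx) (a : Fin _ → C.obj x),
    (c = fun i => C.toLimit x (a i)) ∧ Structure.RelMap R a

/-- The operations of the direct limit do not depend on the chosen representatives. -/
theorem funMap_toLimit {n : ℕ} (F : L.Functions n) (x : C.Idx) (a : Fin n → C.obj x) :
    Structure.funMap F (fun i => C.toLimit x (a i)) = C.toLimit x (Structure.funMap F a) := by
  have key : ∀ c : Fin n → C.Limit, (c = fun i => C.toLimit x (a i)) →
      Structure.funMap F c = C.toLimit x (Structure.funMap F a) := by
    intro c hc
    have hs := (C.exists_tuple c).choose_spec.choose_spec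
    obtain ⟨z, hx, hy, h⟩ := C.exists_map_eq _ a (fun i => congrFun (hs.symm.trans hc) i)
    refine (C.toLimit_eq_iff _ _).2 ⟨z, hx, hy, ?_⟩
    rw [Hom.map_fun, Hom.map_fun]
    exact congrArg _ (funext h)
  exact key _ rfl

/-- A basic relation holds of a tuple of the direct limit coming from a member of the chain exactly
when it holds at some later stage. -/
theorem relMap_toLimit {n : ℕ} (R : L.Relations n) (x : C.Idx) (a : Fin n → C.obj x) :
    Structure.RelMap R (fun i => C.toLimit x (a i)) ↔
      ∃ (y : C.Idx) (h : x ≤ y), Structure.RelMap R (fun i => C.map x y h (a i)) := by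
  constructor
  · rintro ⟨y, b, hb, hR⟩
    obtain ⟨z, hx, hy, h⟩ := C.exists_map_eq a b (fun i => congrFun hb i)
    refine ⟨z, hx, ?_⟩
    rw [funext h]
    exact (C.map y z hy).map_rel R b hR
  · rintro ⟨y, h, hR⟩
    exact ⟨y, _, funext fun i => (C.toLimit_map h (a i)).symm, hR⟩

end Chain

/-! ### Class operators -/

/-- `N ∈ L_C(K)`: `N` is isomorphic to the direct limit of a chain of members of `K`. -/
def InLC {L : FirstOrder.Language.{u, v}} (K : ∀ (G : Type w) [L.Structure G], Prop)
    (N : Type w') [L.Structure N] : Prop :=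
  ∃ C : Chain.{u, v, w, w'} L, (∀ x, K (C.obj x)) ∧ Nonempty (N ≃[L] C.Limit)

/-- `N ∈ P_U(M)`: `N` is isomorphic to an ultrapower of `M`. -/
def InPU (L : FirstOrder.Language.{u, v}) (M : Type w) [L.Structure M] (N : Type w') [L.Structure N] :
    Prop :=
  ∃ (I : Type w') (U : Ultrafilter I),
    Nonempty (N ≃[L] (U : Filter I).Product (fun _ : I => M))

/-- `N ∈ L_C P_U(M)`: `N` is isomorphic to the direct limit of a chain of ultrapowers of `M`. -/
def InLCPU (L : FirstOrder.Language.{u, v}) (M : Type w) [L.Structure M] (N : Type (max u v w))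
    [L.Structure N] : Prop :=
  InLC (fun (G : Type (max u v w)) [L.Structure G] => InPU L M G) N

/-- `N ∈ L_C(M)`: `N` is isomorphic to the direct limit of a chain of copies of `M`. -/
def InLCSelf (L : FirstOrder.Language.{u, v}) (M : Type w) [L.Structure M] (N : Type w')
    [L.Structure N] : Prop :=
  InLC (fun (G : Type w) [L.Structure G] => Nonempty (G ≃[L] M)) N

end PositiveLogic

-- A model K of Th⁺(M) has the same positive sentences as M, so positive sets finitely satisfiable
-- in K are finitely satisfiable in M (`FinSat.of_posLe`). Take the positive diagram of K, with
-- fresh variables realizing every finitely satisfiable positive type over a finite tuple; enlarge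
-- it by Zorn to a maximal set and realize that in an ultrapower K' of M. The K-coordinates give h :
-- K → K'. By maximality (`IsMaximalType.posLe`), a positive formula false of h(a) stays false under
-- every homomorphism from K' to a model of Th⁺(M).
--
-- Iterate ω times. A positive sentence true in the limit is true at some stage, so the limit models
-- Th⁺(M). It is pec because the positive type of a tuple is final one stage later. It is positively
-- ω-saturated because a type over stage x is finitely satisfiable at stage x + 1, hence realized at
-- stage x + 2.
--
-- If M is positively saturated, M replaces the ultrapower: a recursion along a well-order of type
-- |M| (`IsPositivelySaturated.exists_posLe`), or for finite M the finiteness of the set of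
-- valuations, realizes a maximal extension of its diagram in M itself. This gives h : M → M; types
-- over finite tuples are already realized in M, so the constant sequence with map h suffices.

universe u₁ u₂ u₃ u₄

namespace PositiveLogic

open FirstOrder FirstOrder.Language Cardinal
open scoped FirstOrder

/-! ### Syntax of positive formulas and preservation by homomorphisms -/

section PositiveFormulas

variable {L : FirstOrder.Language.{u, v}} {α : Type u₁} {β : Type u₂}
variable {M : Type u₃} {N : Type u₄} [L.Structure M] [L.Structure N]

theorem IsPositive.boundedRelabel {n m : ℕ} {φ : L.BoundedFormula α n} (h : IsPositive φ)
    (g : α → β ⊕ Fin m) : IsPositive (φ.relabel g) := by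
  induction h with
  | falsum => exact .falsum
  | atomic h => exact .atomic (h.relabel g)
  | inf _ _ h₁ h₂ => exact .inf h₁ h₂
  | sup _ _ h₁ h₂ => exact .sup h₁ h₂
  | ex _ ih =>
    rw [BoundedFormula.relabel_ex]
    exact .ex ih

theorem IsPositive.relabel {φ : L.Formula α} (h : IsPositive φ) (g : α → β) :
    IsPositive (φ.relabel g) :=
  h.boundedRelabel _

theorem IsPositive.exs {n : ℕ} {φ : L.BoundedFormula α n} (h : IsPositive φ) :
    IsPositive φ.exs := by
  induction n with
  | zero => exact h
  | succ n ih => exact ih h.ex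

theorem IsPositive.iExs [Finite β] {φ : L.Formula (α ⊕ β)} (h : IsPositive φ) :
    IsPositive (φ.iExs β) :=
  (h.boundedRelabel _).exs

/-- The base θ is arbitrary because ⊤ is not a positive formula. -/
theorem IsPositive.foldr_inf {n : ℕ} {θ : L.BoundedFormula α n} (hθ : IsPositive θ)
    (l : List (L.BoundedFormula α n)) (hl : ∀ φ ∈ l, IsPositive φ) :
    IsPositive (l.foldr (· ⊓ ·) θ) := by
  induction l with
  | nil => exact hθ
  | cons φ l ih =>
    exact .inf (hl φ (by simp)) (ih fun ψ hψ => hl ψ (by simp [hψ]))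

theorem realize_foldr_inf {n : ℕ} (θ : L.BoundedFormula α n) (l : List (L.BoundedFormula α n))
    (a : α → M) (xs : Fin n → M) :
    (l.foldr (· ⊓ ·) θ).Realize a xs ↔ (∀ φ ∈ l, φ.Realize a xs) ∧ θ.Realize a xs := by
  induction l with
  | nil => simp
  | cons φ l ih => simp [ih, and_assoc]

/-- Homomorphisms preserve positive formulas. -/
theorem IsPositive.realize_hom {n : ℕ} {φ : L.BoundedFormula α n} (h : IsPositive φ)
    (f : M →[L] N) {a : α → M} {xs : Fin n → M} (hφ : φ.Realize a xs) :
    φ.Realize (f ∘ a) (f ∘ xs) := by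
  induction h with
  | falsum => exact hφ
  | atomic h =>
    cases h with
    | equal t₁ t₂ =>
      rw [BoundedFormula.realize_bdEqual] at hφ ⊢
      rw [← Sum.comp_elim, HomClass.realize_term, HomClass.realize_term, hφ]
    | rel R ts =>
      rw [BoundedFormula.realize_rel] at hφ ⊢
      simp only [← Sum.comp_elim, HomClass.realize_term]
      exact f.map_rel R _ hφ
  | inf _ _ h₁ h₂ =>
    rw [BoundedFormula.realize_inf] at hφ ⊢
    exact ⟨h₁ hφ.1, h₂ hφ.2⟩
  | sup _ _ h₁ h₂ =>
    rw [BoundedFormula.realize_sup] at hφ ⊢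
    exact hφ.imp h₁ h₂
  | ex _ ih =>
    rw [BoundedFormula.realize_ex] at hφ ⊢
    obtain ⟨b, hb⟩ := hφ
    refine ⟨f b, ?_⟩
    rw [← Fin.comp_snoc]
    exact ih hb

theorem IsPositive.formula_realize_hom {φ : L.Formula α} (h : IsPositive φ) (f : M →[L] N)
    {a : α → M} (hφ : φ.Realize a) : φ.Realize (f ∘ a) := by
  have := h.realize_hom f hφ
  rwa [Subsingleton.elim (f ∘ default) default] at this

theorem realize_congr_freeVarFinset [DecidableEq α] {φ : L.Formula α} {a b : α → M}
    (h : ∀ x ∈ φ.freeVarFinset, a x = b x) : φ.Realize a ↔ φ.Realize b := by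
  have ha := BoundedFormula.realize_restrictFreeVar (φ := φ) (f := id) (v := fun x => a x)
    (xs := default) a (fun _ => rfl)
  have hb := BoundedFormula.realize_restrictFreeVar (φ := φ) (f := id) (v := fun x => a x)
    (xs := default) b (fun x => h x x.2)
  exact ha.symm.trans hb

/-- Serves to rename the finitely many free variables of a formula into `Fin n`, where they can be
quantified. -/
theorem exists_finite_retraction (s : Finset α) :
    ∃ (n : ℕ) (g : α → Fin n) (c : Fin n → α), ∀ x ∈ s, c (g x) = x := by
  classical
  rcases isEmpty_or_nonempty α with _ | ⟨⟨x₀⟩⟩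
  · exact ⟨0, isEmptyElim, Fin.elim0, fun x => isEmptyElim x⟩
  -- The extra point gives the elements outside s a value even when s is empty.
  · let t := insert x₀ s
    refine ⟨t.card, fun x => t.equivFin (if h : x ∈ t then ⟨x, h⟩ else ⟨x₀, by simp [t]⟩),
      fun i => t.equivFin.symm i, fun x hx => ?_⟩
    have : x ∈ t := by simp [t, hx]
    simp [this]

end PositiveFormulas

/-! ### Comparison of positive types, and maximal types -/

section PositiveTypes

variable {L : FirstOrder.Language.{u, v}} {α : Type u₁} {β : Type u₂}
variable {K : Type u₃} {M : Type u₄} {N : Type w} [L.Structure K] [L.Structure M] [L.Structure N]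

variable (L) in
/-- Every positive formula satisfied by the tuple `a` is satisfied by the tuple `b`. -/
def PosLe (a : α → K) (b : α → M) : Prop :=
  ∀ φ : L.Formula α, IsPositive φ → φ.Realize a → φ.Realize b

theorem PosLe.comp {a : α → K} {b : α → M} (h : PosLe L a b) (g : β → α) :
    PosLe L (a ∘ g) (b ∘ g) := by
  intro φ hφ ha
  rw [← Formula.realize_relabel] at ha ⊢
  exact h _ (hφ.relabel g) ha

theorem PosLe.trans {a : α → K} {b : α → M} {c : α → N} (h : PosLe L a b) (h' : PosLe L b c) :
    PosLe L a c :=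
  fun φ hφ ha => h' φ hφ (h φ hφ ha)

theorem posLe_hom_comp (f : K →[L] M) (a : α → K) : PosLe L a (f ∘ a) :=
  fun _ hφ ha => hφ.formula_realize_hom f ha

theorem PosLe.sentences_of_hom (f : K →[L] M) :
    PosLe L (default : Empty → K) (default : Empty → M) := by
  have := posLe_hom_comp f (default : Empty → K)
  rwa [Subsingleton.elim (f ∘ default) default] at this

theorem posLe_of_finite {a : α → K} {b : α → M}
    (h : ∀ (n : ℕ) (c : Fin n → α), PosLe L (a ∘ c) (b ∘ c)) : PosLe L a b := by
  classical
  intro φ hφ ha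
  obtain ⟨n, g, c, hc⟩ := exists_finite_retraction φ.freeVarFinset
  have := h n c (φ.relabel g) (hφ.relabel g)
  rw [Formula.realize_relabel, Formula.realize_relabel] at this
  rw [realize_congr_freeVarFinset (b := (b ∘ c) ∘ g) fun x hx => by simp [hc x hx] ]
  refine this ?_
  rwa [← realize_congr_freeVarFinset (a := a) fun x hx => by simp [hc x hx] ]

theorem exists_isPositive_realize {q : Set (L.Formula α)} (hpos : ∀ φ ∈ q, IsPositive φ)
    {a : α → K} (ha : ∀ φ ∈ q, φ.Realize a) (hne : q.Nonempty ∨ Nonempty α) :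
    ∃ θ : L.Formula α, IsPositive θ ∧ θ.Realize a := by
  rcases hne with ⟨φ, hφ⟩ | ⟨⟨x⟩⟩
  · exact ⟨φ, hpos φ hφ, ha φ hφ⟩
  · refine ⟨Term.equal (Term.var x) (Term.var x), .atomic (.equal _ _), ?_⟩
    simp

/-- A finite set of positive formulas satisfied by an extension of `a` is also satisfied by an
extension of any `b` with a larger positive type. -/
theorem PosLe.exists_realize {a : α → K} {b : α → M} (h : PosLe L a b)
    {q : Set (L.Formula (α ⊕ β))} (hq : q.Finite) (hpos : ∀ φ ∈ q, IsPositive φ)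
    (hK : ∃ c : β → K, ∀ φ ∈ q, φ.Realize (Sum.elim a c)) :
    ∃ c : β → M, ∀ φ ∈ q, φ.Realize (Sum.elim b c) := by
  classical
  obtain ⟨c, hc⟩ := hK
  -- A true positive formula is needed to start the conjunction: a member of q, or x = x. With
  -- neither available the claim is trivial.
  by_cases hne : q.Nonempty ∨ Nonempty (α ⊕ β)
  · obtain ⟨θ, hθ, hθa⟩ := exists_isPositive_realize hpos hc hne
    let χ : L.Formula (α ⊕ β) := hq.toFinset.toList.foldr (· ⊓ ·) θ
    have hχ : IsPositive χ := hθ.foldr_inf _ fun φ hφ => hpos φ (by simpa using hφ)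
    have hχc : χ.Realize (Sum.elim a c) :=
      (realize_foldr_inf _ _ _ _).2 ⟨fun φ hφ => hc φ (by simpa using hφ), hθa⟩
    obtain ⟨n, g, d, hd⟩ := exists_finite_retraction χ.freeVarFinset.toRight
    have key := h _ (hχ.relabel (Sum.map id g)).iExs
    simp only [Formula.realize_iExs, Formula.realize_relabel] at key
    obtain ⟨e, he⟩ := key ⟨c ∘ d, by
      rwa [realize_congr_freeVarFinset (b := Sum.elim a c)]
      rintro (x | x) hx
      · rfl
      · simp [hd x (by simpa using hx)]⟩
    rw [Sum.elim_comp_map, Function.comp_id] at he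
    exact ⟨e ∘ g, fun φ hφ => ((realize_foldr_inf _ _ _ _).1 he).1 φ (by simpa using hφ)⟩
  · push Not at hne
    have := (isEmpty_sum.1 hne.2).2
    exact ⟨isEmptyElim, by simp [hne.1]⟩

variable (M) in
/-- Every finite subset of `p` is realized in `M`. -/
def FinSat (p : Set (L.Formula α)) : Prop :=
  ∀ q ⊆ p, q.Finite → ∃ a : α → M, ∀ φ ∈ q, φ.Realize a

theorem PosLe.exists_realize_of_default
    (h : PosLe L (default : Empty → K) (default : Empty → M))
    {q : Set (L.Formula α)} (hq : q.Finite) (hpos : ∀ φ ∈ q, IsPositive φ)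
    (hK : ∃ a : α → K, ∀ φ ∈ q, φ.Realize a) : ∃ a : α → M, ∀ φ ∈ q, φ.Realize a := by
  have := h.exists_realize (hq.image (Formula.relabel (Sum.inr : α → Empty ⊕ α)))
    (by rintro _ ⟨φ, hφ, rfl⟩; exact (hpos φ hφ).relabel _)
  simpa only [Set.forall_mem_image, Formula.realize_relabel, Sum.elim_comp_inr, hK,
    forall_const] using this

theorem FinSat.of_posLe (h : PosLe L (default : Empty → K) (default : Empty → M))
    {p : Set (L.Formula α)} (hpos : ∀ φ ∈ p, IsPositive φ) (hp : FinSat K p) : FinSat M p :=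
  fun q hqp hq => h.exists_realize_of_default hq (fun φ hφ => hpos φ (hqp hφ)) (hp q hqp hq)

theorem exists_realize_of_finite_valuations [Finite (α → M)] {p : Set (L.Formula α)}
    (hp : FinSat M p) : ∃ a : α → M, ∀ φ ∈ p, φ.Realize a := by
  by_contra! hcon
  choose f hfp hf using hcon
  obtain ⟨a, ha⟩ := hp (Set.range f) (Set.range_subset_iff.2 hfp) (Set.finite_range f)
  exact hf a (ha _ ⟨a, rfl⟩)

variable (M) in
/-- `p` is maximal among the sets of positive formulas that are finitely satisfiable in `M`. -/
structure IsMaximalType (p : Set (L.Formula α)) : Prop where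
  isPositive : ∀ φ ∈ p, IsPositive φ
  finSat : FinSat M p
  exists_inconsistent : ∀ φ : L.Formula α, IsPositive φ → φ ∉ p →
    ∃ q ⊆ p, q.Finite ∧ ¬ ∃ a : α → M, φ.Realize a ∧ ∀ ψ ∈ q, ψ.Realize a

theorem FinSat.exists_isMaximalType {p : Set (L.Formula α)} (hpos : ∀ φ ∈ p, IsPositive φ)
    (hp : FinSat M p) : ∃ p', p ⊆ p' ∧ IsMaximalType M p' := by
  obtain ⟨m, hpm, hm⟩ := zorn_subset_nonempty {r : Set (L.Formula α) |
      (∀ φ ∈ r, IsPositive φ) ∧ FinSat M r} (by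
    intro c hc hchain hne
    refine ⟨⋃₀ c, ⟨?_, ?_⟩, fun s hs => Set.subset_sUnion_of_mem hs⟩
    · rintro φ ⟨s, hs, hφ⟩
      exact (hc hs).1 φ hφ
    · intro q hq hfin
      obtain ⟨t, ht, hqt⟩ := DirectedOn.exists_mem_subset_of_finset_subset_biUnion
        (s := hfin.toFinset) (f := id) hne hchain.directedOn (by simpa [Set.sUnion_eq_biUnion] using hq)
      exact (hc ht).2 q (by simpa using hqt) hfin) p ⟨hpos, hp⟩
  refine ⟨m, hpm, hm.prop.1, hm.prop.2, fun φ hφ hφm => ?_⟩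
  by_contra! hcon
  refine hφm (hm.mem_of_prop_insert ⟨?_, ?_⟩)
  · rintro ψ (rfl | hψ)
    exacts [hφ, hm.prop.1 ψ hψ]
  · intro q hq hfin
    obtain ⟨a, ha, haq⟩ := hcon (q \ {φ}) (by simpa using hq) hfin.sdiff
    refine ⟨a, fun ψ hψ => ?_⟩
    by_cases h : ψ = φ
    · rwa [h]
    · exact haq ψ ⟨hψ, h⟩

/-- If φ holds of b but not of a, then φ ∉ p, so φ is inconsistent in M with a finite part of p. But
b satisfies both, and this existential fact transfers from N to M. -/
theorem IsMaximalType.posLe {p : Set (L.Formula α)} (hp : IsMaximalType M p) {a : α → K}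
    (ha : ∀ φ ∈ p, φ.Realize a) {b : α → N} (hab : PosLe L a b)
    (hN : PosLe L (default : Empty → N) (default : Empty → M)) : PosLe L b a := by
  intro φ hφ hb
  by_contra hcon
  obtain ⟨q, hqp, hq, hne⟩ := hp.exists_inconsistent φ hφ fun h => hcon (ha φ h)
  refine hne ?_
  have := hN.exists_realize_of_default (hq.insert φ)
    (by rintro ψ (rfl | hψ); exacts [hφ, hp.isPositive ψ (hqp hψ)])
    ⟨b, by
      rintro ψ (rfl | hψ)
      exacts [hb, hab ψ (hp.isPositive ψ (hqp hψ)) (ha ψ (hqp hψ))]⟩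
  simpa using this

/-- A map realizing at least the positive type of the identity tuple is a homomorphism. -/
def PosLe.toHom {f : K → M} (h : PosLe L (id : K → K) f) : K →[L] M where
  toFun := f
  map_fun' {n} F a := by
    have := h (Term.equal (Term.func F fun i => Term.var (a i)) (Term.var (Structure.funMap F a)))
      (.atomic (.equal _ _)) (by simp)
    simpa [Function.comp_def] using this.symm
  map_rel' {n} R a hR := by
    have := h (Relations.formula R fun i => Term.var (a i)) (.atomic (.rel R _)) (by simpa using hR)
    simpa [Function.comp_def] using this

/-- Sentences are formulas in the variables `Empty`, so Th⁺ amounts to equality of the positive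
types of the empty tuple. -/
theorem models_thPlus_iff : K ⊨ thPlus L M ↔
    PosLe L (default : Empty → K) (default : Empty → M) ∧
      PosLe L (default : Empty → M) (default : Empty → K) := by
  constructor
  · intro h
    refine ⟨fun φ hφ hK => ?_, fun φ hφ hM => ?_⟩
    · by_contra hcon
      exact h.realize_of_mem (∼φ) (Or.inr ⟨φ, hφ, hcon, rfl⟩) hK
    · exact h.realize_of_mem φ (Or.inl ⟨hφ, hM⟩)
  · rintro ⟨h₁, h₂⟩
    refine ⟨?_⟩
    rintro φ (⟨hφ, hM⟩ | ⟨φ, hφ, hM, rfl⟩)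
    · exact h₂ φ hφ hM
    · exact fun hK => hM (h₁ φ hφ hK)

end PositiveTypes

/-! ### Compactness by ultrapowers -/

section Ultrapowers

variable {L : FirstOrder.Language.{u, v}} {M : Type w} [L.Structure M]

variable (L) in
-- Covers the case M = ∅, kept apart from the uses of Łoś's theorem; only nullary relations matter.
theorem nonempty_equiv_ultrapower_of_isEmpty [IsEmpty M] {I : Type u₁} (U : Ultrafilter I) :
    Nonempty (M ≃[L] (U : Filter I).Product (fun _ : I => M)) := by
  have : Nonempty I := Filter.nonempty_of_neBot (U : Filter I)
  have hP : IsEmpty ((U : Filter I).Product (fun _ : I => M)) :=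
    ⟨Quotient.ind fun x => isEmptyElim (x (Classical.arbitrary I))⟩
  refine ⟨⟨Equiv.equivOfIsEmpty _ _, fun F a => isEmptyElim (Structure.funMap F a),
    fun {n} R a => ?_⟩⟩
  have ha : Equiv.equivOfIsEmpty M ((U : Filter I).Product (fun _ : I => M)) ∘ a =
      fun i => ((fun _ => a i : I → M) : (U : Filter I).Product (fun _ => M)) :=
    funext fun i => isEmptyElim (a i)
  change Structure.RelMap R (Equiv.equivOfIsEmpty M _ ∘ a) ↔ _
  rw [ha]
  refine (relMap_quotient_mk' (s := (U : Filter I).productSetoid fun _ => M) R _).trans ?_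
  exact Filter.eventually_const

theorem FinSat.exists_ultrapower {α : Type u₁} {p : Set (L.Formula α)} (hp : FinSat M p) :
    ∃ (I : Type (max u v u₁)) (U : Ultrafilter I)
      (a : α → (U : Filter I).Product (fun _ : I => M)), ∀ φ ∈ p, φ.Realize a := by
  classical
  have hne (q : Finset p) : ∃ a : α → M, ∀ φ ∈ q, φ.1.Realize a := by
    obtain ⟨a, ha⟩ := hp (Subtype.val '' (q : Set p)) (by simp) (q.finite_toSet.image _)
    exact ⟨a, fun φ hφ => ha _ ⟨φ, hφ, rfl⟩⟩
  choose a ha using hne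
  -- Refining `atTop` makes the set of q containing a given φ large.
  let U : Ultrafilter (Finset p) := Ultrafilter.of Filter.atTop
  rcases isEmpty_or_nonempty M with hM | hM
  · obtain ⟨e⟩ := nonempty_equiv_ultrapower_of_isEmpty (M := M) L U
    have : IsEmpty α := ⟨fun x => isEmptyElim (a ∅ x)⟩
    refine ⟨Finset p, U, e ∘ isEmptyElim, fun φ hφ => ?_⟩
    rw [StrongHomClass.realize_formula]
    have := ha {⟨φ, hφ⟩} ⟨φ, hφ⟩ (by simp)
    rwa [Subsingleton.elim (a _) isEmptyElim] at this
  · refine ⟨Finset p, U, fun x => ((fun q => a q x : Finset p → M) :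
      (U : Filter (Finset p)).Product (fun _ => M)), fun φ hφ => ?_⟩
    refine (Ultraproduct.realize_formula_cast φ fun x q => a q x).2 ?_
    refine Ultrafilter.of_le _ ?_
    filter_upwards [Filter.eventually_ge_atTop ({⟨φ, hφ⟩} : Finset p)] with q hq
    exact ha q ⟨φ, hφ⟩ (hq (by simp))

theorem InPU.models_thPlus {N : Type w'} [L.Structure N] (h : InPU L M N) : N ⊨ thPlus L M := by
  obtain ⟨I, U, ⟨e⟩⟩ := h
  suffices (U : Filter I).Product (fun _ : I => M) ⊨ thPlus L M from
    (StrongHomClass.theory_model (L := L) e.symm)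
  rcases isEmpty_or_nonempty M with hM | hM
  · obtain ⟨e⟩ := nonempty_equiv_ultrapower_of_isEmpty (M := M) L U
    exact models_thPlus_iff.2
      ⟨PosLe.sentences_of_hom e.symm.toHom, PosLe.sentences_of_hom e.toHom⟩
  · have key (φ : L.Sentence) : (U : Filter I).Product (fun _ : I => M) ⊨ φ ↔ M ⊨ φ := by
      rw [Ultraproduct.sentence_realize]
      exact Filter.eventually_const
    exact models_thPlus_iff.2 ⟨fun φ _ => (key φ).1, fun φ _ => (key φ).2⟩

end Ultrapowers

/-! ### Positive formulas in direct limits of chains -/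

section Limits

variable {L : FirstOrder.Language.{u, v}}

namespace Chain

variable (C : Chain.{u, v, w, w'} L)

/-- The canonical homomorphism of a member of the chain to the direct limit. -/
def toLimitHom (x : C.Idx) : C.obj x →[L] C.Limit where
  toFun := C.toLimit x
  map_fun' F a := (C.funMap_toLimit F x a).symm
  map_rel' R a hR := (C.relMap_toLimit R x a).2 ⟨x, le_rfl, by simpa [C.map_self] using hR⟩

theorem toLimitHom_comp_map {x y : C.Idx} (h : x ≤ y) :
    C.toLimitHom y ∘ C.map x y h = C.toLimitHom x :=
  funext (C.toLimit_map h)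

theorem map_comp_map {x y z : C.Idx} (hxy : x ≤ y) (hyz : y ≤ z) :
    C.map y z hyz ∘ C.map x y hxy = C.map x z (hxy.trans hyz) :=
  funext (C.map_map x y z hxy hyz)

/-- A positive formula true in the direct limit is true at some stage of the chain. -/
theorem exists_realize_of_toLimit {α : Type u₁} {n : ℕ} {φ : L.BoundedFormula α n}
    (hφ : IsPositive φ) {x : C.Idx} (a : α → C.obj x) (xs : Fin n → C.obj x)
    (h : φ.Realize (C.toLimitHom x ∘ a) (C.toLimitHom x ∘ xs)) :
    ∃ (y : C.Idx) (hxy : x ≤ y), φ.Realize (C.map x y hxy ∘ a) (C.map x y hxy ∘ xs) := by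
  induction hφ generalizing x with
  | falsum => exact h.elim
  | atomic hφ =>
    cases hφ with
    | equal t₁ t₂ =>
      rw [BoundedFormula.realize_bdEqual] at h
      rw [← Sum.comp_elim, HomClass.realize_term, HomClass.realize_term] at h
      obtain ⟨y, hxy, hxy', he⟩ := (C.toLimit_eq_iff _ _).1 h
      refine ⟨y, hxy, ?_⟩
      rw [BoundedFormula.realize_bdEqual, ← Sum.comp_elim, HomClass.realize_term,
        HomClass.realize_term]
      exact he
    | rel R ts =>
      rw [BoundedFormula.realize_rel] at h
      simp only [← Sum.comp_elim, HomClass.realize_term] at h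
      obtain ⟨y, hxy, hR⟩ := (C.relMap_toLimit R x _).1 h
      refine ⟨y, hxy, ?_⟩
      rw [BoundedFormula.realize_rel]
      simpa only [← Sum.comp_elim, HomClass.realize_term] using hR
  | inf h₁ h₂ ih₁ ih₂ =>
    rw [BoundedFormula.realize_inf] at h
    obtain ⟨y, hxy, hy⟩ := ih₁ a xs h.1
    obtain ⟨z, hxz, hz⟩ := ih₂ a xs h.2
    refine ⟨max y z, hxy.trans (le_max_left _ _), ?_⟩
    rw [BoundedFormula.realize_inf]
    constructor
    · rw [← C.map_comp_map hxy (le_max_left y z)]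
      exact h₁.realize_hom _ hy
    · rw [← C.map_comp_map hxz (le_max_right y z)]
      exact h₂.realize_hom _ hz
  | sup h₁ h₂ ih₁ ih₂ =>
    rw [BoundedFormula.realize_sup] at h
    rcases h with h | h
    · obtain ⟨y, hxy, hy⟩ := ih₁ a xs h
      exact ⟨y, hxy, BoundedFormula.realize_sup.2 (Or.inl hy)⟩
    · obtain ⟨y, hxy, hy⟩ := ih₂ a xs h
      exact ⟨y, hxy, BoundedFormula.realize_sup.2 (Or.inr hy)⟩
  | ex hφ ih =>
    rw [BoundedFormula.realize_ex] at h
    obtain ⟨c, hc⟩ := h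
    obtain ⟨z, b, rfl⟩ := C.exists_toLimit c
    have hxm : x ≤ max x z := le_max_left _ _
    have hzm : z ≤ max x z := le_max_right _ _
    rw [← C.toLimitHom_comp_map hxm, ← C.toLimit_map hzm b] at hc
    obtain ⟨y, hmy, hy⟩ := ih (C.map x _ hxm ∘ a) (Fin.snoc (C.map x _ hxm ∘ xs) (C.map z _ hzm b))
      (by rw [Fin.comp_snoc]; exact hc)
    refine ⟨y, hxm.trans hmy, ?_⟩
    rw [BoundedFormula.realize_ex]
    rw [Fin.comp_snoc, ← Function.comp_assoc, ← Function.comp_assoc, C.map_comp_map] at hy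
    exact ⟨_, hy⟩

theorem posLe_sentences_limit {M : Type u₁} [L.Structure M]
    (h : ∀ x, PosLe L (default : Empty → C.obj x) (default : Empty → M)) :
    PosLe L (default : Empty → C.Limit) (default : Empty → M) := by
  intro φ hφ hL
  have x : C.Idx := Classical.arbitrary _
  obtain ⟨y, hxy, hy⟩ := C.exists_realize_of_toLimit hφ (x := x) default default
    (by rw [Subsingleton.elim (_ ∘ default) default,
      Subsingleton.elim (_ ∘ default) (default : Fin 0 → _)]; exact hL)
  refine h y φ hφ ?_
  rwa [Subsingleton.elim (_ ∘ default) default,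
    Subsingleton.elim (_ ∘ default) (default : Fin 0 → _)] at hy

end Chain

/-- The homomorphisms between the members of a sequence of structures. -/
def seqMap {G : ℕ → Type w} [∀ n, L.Structure (G n)] (h : ∀ n, G n →[L] G (n + 1)) {m n : ℕ}
    (hmn : m ≤ n) : G m →[L] G n :=
  Nat.leRecOn hmn (fun {k} f => (h k).comp f) (Hom.id L (G m))

section

variable {G : ℕ → Type w} [∀ n, L.Structure (G n)] (h : ∀ n, G n →[L] G (n + 1))

theorem seqMap_self (m : ℕ) (a : G m) : seqMap h (le_refl m) a = a := by
  rw [seqMap, Nat.leRecOn_self]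
  rfl

theorem seqMap_succ {m n : ℕ} (hmn : m ≤ n) (a : G m) :
    seqMap h (Nat.le_succ_of_le hmn) a = h n (seqMap h hmn a) := by
  rw [seqMap, Nat.leRecOn_succ hmn]
  rfl

theorem seqMap_seqMap {m n k : ℕ} (hmn : m ≤ n) (hnk : n ≤ k) (a : G m) :
    seqMap h hnk (seqMap h hmn a) = seqMap h (hmn.trans hnk) a := by
  induction hnk with
  | refl => exact seqMap_self h _ _
  | step hk ih =>
    rw [seqMap_succ h hk, ih, ← seqMap_succ h]

/-- The chain given by a sequence of structures and homomorphisms. -/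
def seqChain : Chain.{u, v, w, w'} L where
  Idx := ULift.{w'} ℕ
  obj x := G x.down
  map _ _ hxy := seqMap h hxy
  map_self x := seqMap_self h x.down
  map_map _ _ _ hxy hyz := seqMap_seqMap h hxy hyz

end

end Limits

/-! ### Limits of ω-sequences: pec and saturation -/

section Sequences

variable {L : FirstOrder.Language.{u, v}}

/-- Homomorphisms to models of `Th⁺(M)` that factor through `h` reflect positive formulas on the
range of `h`. -/
def IsPecHom (M : Type w) [L.Structure M] {K : Type u₁} {K' : Type u₂} [L.Structure K]
    [L.Structure K'] (h : K →[L] K') : Prop :=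
  ∀ (G : Type (max u v u₁)) [L.Structure G], G ⊨ thPlus L M → ∀ g : K' →[L] G, PosLe L (g ∘ h) h

/-- Every positive type over a finite tuple of `K` that is finitely satisfiable in `K` is realized
in `K'` over the image of the tuple. -/
def RealizesTypes {K : Type u₁} {K' : Type u₂} [L.Structure K] [L.Structure K']
    (h : K →[L] K') : Prop :=
  ∀ (m n : ℕ) (a : Fin m → K) (p : Set (L.Formula (Fin m ⊕ Fin n))), (∀ φ ∈ p, IsPositive φ) →
    (∀ q ⊆ p, q.Finite → ∃ b : Fin n → K, ∀ φ ∈ q, φ.Realize (Sum.elim a b)) →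
    ∃ b : Fin n → K', ∀ φ ∈ p, φ.Realize (Sum.elim (h ∘ a) b)

variable {M : Type w} [L.Structure M] {G : ℕ → Type w'} [∀ n, L.Structure (G n)]
  {h : ∀ n, G n →[L] G (n + 1)}

theorem seqChain_limit_models (hG : ∀ n, G n ⊨ thPlus L M) :
    (seqChain.{u, v, w', max u v w'} h).Limit ⊨ thPlus L M := by
  refine models_thPlus_iff.2 ⟨Chain.posLe_sentences_limit _ fun x =>
    (models_thPlus_iff.1 (hG x.down)).1, ?_⟩
  exact (models_thPlus_iff.1 (hG 0)).2.trans
    (PosLe.sentences_of_hom ((seqChain.{u, v, w', max u v w'} h).toLimitHom ⟨0⟩))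

variable (h) in
/-- The canonical homomorphism of a member of a sequence to the direct limit. -/
def seqToLimit (n : ℕ) : G n →[L] (seqChain.{u, v, w', max u v w'} h).Limit :=
  (seqChain.{u, v, w', max u v w'} h).toLimitHom ⟨n⟩

theorem seqToLimit_succ_comp (n : ℕ) : seqToLimit h (n + 1) ∘ h n = seqToLimit h n := by
  funext a
  have := seqMap_succ h (le_refl n) a
  rw [seqMap_self] at this
  rw [Function.comp_apply, ← this]
  exact (seqChain h).toLimit_map (show (⟨n⟩ : ULift ℕ) ≤ ⟨n + 1⟩ from Nat.le_succ n) a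

theorem exists_seqToLimit_comp {n : ℕ}
    (c : Fin n → (seqChain.{u, v, w', max u v w'} h).Limit) :
    ∃ (x : ℕ) (a : Fin n → G x), c = seqToLimit h x ∘ a := by
  obtain ⟨⟨x⟩, a, ha⟩ := (seqChain.{u, v, w', max u v w'} h).exists_tuple c
  exact ⟨x, a, ha⟩

theorem isPecModel_seqChain_limit (hG : ∀ n, G n ⊨ thPlus L M) (hpec : ∀ n, IsPecHom M (h n)) :
    IsPecModel (thPlus L M) (seqChain.{u, v, w', max u v w'} h).Limit := by
  refine ⟨seqChain_limit_models hG, fun N _ hN f n φ hφ c => ⟨hφ.formula_realize_hom f, ?_⟩⟩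
  obtain ⟨x, a, rfl⟩ := exists_seqToLimit_comp c
  rw [← seqToLimit_succ_comp]
  intro hφf
  exact hφ.formula_realize_hom (seqToLimit h (x + 1))
    ((hpec x N hN (f.comp (seqToLimit h (x + 1)))).comp a φ hφ hφf)

theorem isPositivelySaturatedFor_seqChain_limit (hG : ∀ n, G n ⊨ thPlus L M)
    (hpec : ∀ n, IsPecHom M (h n)) (hsat : ∀ n, RealizesTypes (h n)) :
    IsPositivelySaturatedFor L ℵ₀ (seqChain.{u, v, w', max u v w'} h).Limit := by
  intro A hA n p hp hfin
  have : Finite A := Cardinal.lt_aleph0_iff_finite.1 hA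
  obtain ⟨m, ⟨e⟩⟩ := Finite.exists_equiv_fin A
  obtain ⟨x, a, ha⟩ := exists_seqToLimit_comp fun i => (e.symm i).1
  have ha' : (fun y : A => y.1) = (seqToLimit h x ∘ a) ∘ e := by
    rw [← ha]
    funext y
    simp
  have hlim : PosLe L (seqToLimit h x ∘ a) (h x ∘ a) := by
    -- The limit is itself a model of Th⁺(M), in the universe over which `IsPecHom` quantifies, so
    -- what it says positively of a holds already at stage x + 1.
    have := hpec x _ (seqChain_limit_models hG) (seqToLimit h (x + 1))
    rw [seqToLimit_succ_comp] at this
    exact this.comp a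
  have hreal {b : Fin n → (seqChain.{u, v, w', max u v w'} h).Limit}
      {φ : L.Formula (A ⊕ Fin n)} : (φ.relabel (Sum.map e id)).Realize
        (Sum.elim (seqToLimit h x ∘ a) b) ↔ φ.Realize (Sum.elim (fun y : A => y.1) b) := by
    rw [Formula.realize_relabel, Sum.elim_comp_map, Function.comp_id, ha']
  -- Stage x need not satisfy the finite parts of p; by `hlim`, stage x + 1 does.
  obtain ⟨b, hb⟩ := hsat (x + 1) m n (h x ∘ a) (Formula.relabel (Sum.map e id) '' p)
    (by rintro _ ⟨φ, hφ, rfl⟩; exact (hp φ hφ).relabel _) (by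
      intro q hq hqf
      obtain ⟨q', hq', hqf', rfl⟩ :=
        Set.exists_subset_image_finite_and (p := (· = q)).1 ⟨q, hq, hqf, rfl⟩
      refine hlim.exists_realize hqf
        (by rintro _ ⟨φ, hφ, rfl⟩; exact (hp φ (hq' hφ)).relabel _) ?_
      obtain ⟨b, hb⟩ := hfin q' hq' hqf'
      exact ⟨b, by rintro _ ⟨φ, hφ, rfl⟩; exact hreal.2 (hb φ hφ)⟩)
  refine ⟨seqToLimit h (x + 1 + 1) ∘ b, fun φ hφ => hreal.1 ?_⟩
  have := ((hp φ hφ).relabel (Sum.map e id)).formula_realize_hom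
    (seqToLimit h (x + 1 + 1)) (hb _ ⟨φ, hφ, rfl⟩)
  rwa [Sum.comp_elim, ← Function.comp_assoc, seqToLimit_succ_comp, ← Function.comp_assoc,
    seqToLimit_succ_comp] at this

end Sequences

/-! ### One step of the construction -/

section Steps

variable {L : FirstOrder.Language.{u, v}} {M : Type w} [L.Structure M]

variable (L) in
/-- The finitely satisfiable positive types over finite tuples of `K`. -/
structure TupleType (K : Type u₁) [L.Structure K] where
  /-- the number of parameters -/
  m : ℕ
  /-- the number of variables -/
  n : ℕ
  /-- the parameters -/
  param : Fin m → K
  /-- the formulas -/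
  formulas : Set (L.Formula (Fin m ⊕ Fin n))
  isPositive : ∀ φ ∈ formulas, IsPositive φ
  finSat : ∀ q ⊆ formulas, q.Finite →
    ∃ b : Fin n → K, ∀ φ ∈ q, φ.Realize (Sum.elim param b)

namespace TupleType

variable {K : Type u₁} [L.Structure K]

/-- The tuple consisting of the parameters of `t` and of new variables. -/
def vars (t : TupleType L K) : Fin t.m ⊕ Fin t.n → K ⊕ (Σ t : TupleType L K, Fin t.n) :=
  Sum.elim (Sum.inl ∘ t.param) fun i => Sum.inr ⟨t, i⟩

variable (L K) in
/-- The positive formulas true in `K`, together with those asserting that the new variables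
realize the types over finite tuples of `K`. -/
def diagram : Set (L.Formula (K ⊕ (Σ t : TupleType L K, Fin t.n))) :=
  Formula.relabel Sum.inl '' {φ : L.Formula K | IsPositive φ ∧ φ.Realize id} ∪
    (fun s : Σ t : TupleType L K, L.Formula (Fin t.m ⊕ Fin t.n) => s.2.relabel s.1.vars) ''
      {s | s.2 ∈ s.1.formulas}

theorem isPositive_of_mem_diagram : ∀ φ ∈ diagram L K, IsPositive φ := by
  rintro _ (⟨φ, hφ, rfl⟩ | ⟨⟨t, φ⟩, hφ, rfl⟩)
  · exact hφ.1.relabel _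
  · exact (t.isPositive φ hφ).relabel _

/-- Old variables name themselves. Different types use disjoint blocks of new variables, so their
finite parts are satisfied independently. -/
theorem finSat_diagram : FinSat K (diagram L K) := by
  intro q hq hfin
  obtain ⟨s, hs, hsf, hqs⟩ := Set.exists_subset_image_finite_and
    (p := (· = q \ (Formula.relabel Sum.inl '' {φ : L.Formula K | IsPositive φ ∧ φ.Realize id}))).1
    ⟨_, Set.sdiff_subset_iff.2 hq, hfin.sdiff, rfl⟩
  choose b hb using fun t : TupleType L K => t.finSat {φ | (⟨t, φ⟩ : Σ t : TupleType L K, L.Formula (Fin t.m ⊕ Fin t.n)) ∈ s}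
    (fun φ hφ => hs hφ) (hsf.preimage (sigma_mk_injective.injOn))
  refine ⟨Sum.elim id fun y => b y.1 y.2, fun ψ hψ => ?_⟩
  by_cases h : ψ ∈ Formula.relabel Sum.inl '' {φ : L.Formula K | IsPositive φ ∧ φ.Realize id}
  · obtain ⟨φ, hφ, rfl⟩ := h
    rw [Formula.realize_relabel, Sum.elim_comp_inl]
    exact hφ.2
  · obtain ⟨⟨t, φ⟩, hφ, rfl⟩ := hqs.symm.subset ⟨hψ, h⟩
    rw [Formula.realize_relabel]
    convert hb t φ hφ using 1
    funext i
    rcases i with i | i <;> rfl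

end TupleType

theorem IsMaximalType.isPecHom {K : Type u₁} {K' : Type u₂} [L.Structure K] [L.Structure K']
    {X : Type u₃} {p : Set (L.Formula X)} (hp : IsMaximalType M p) {a : X → K'}
    (ha : ∀ φ ∈ p, φ.Realize a) (h : K →[L] K') (i : K → X) (hh : h = a ∘ i) :
    IsPecHom M h := by
  intro G _ hG g
  rw [hh]
  exact (hp.posLe ha (posLe_hom_comp g a) (models_thPlus_iff.1 hG).1).comp i

theorem exists_ultrapower_step (M : Type w) [L.Structure M] (K : Type (max u v w)) [L.Structure K]
    (hK : K ⊨ thPlus L M) :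
    ∃ (K' : Type (max u v w)) (_ : L.Structure K') (h : K →[L] K'),
      InPU L M K' ∧ IsPecHom M h ∧ RealizesTypes h := by
  obtain ⟨p, hdp, hp⟩ := (TupleType.finSat_diagram.of_posLe (models_thPlus_iff.1 hK).1
    TupleType.isPositive_of_mem_diagram).exists_isMaximalType
      (TupleType.isPositive_of_mem_diagram (L := L) (K := K))
  obtain ⟨I, U, a, ha⟩ := hp.finSat.exists_ultrapower
  have hid : PosLe L (id : K → K) (a ∘ Sum.inl) := fun φ hφ hK => by
    rw [← Formula.realize_relabel]
    exact ha _ (hdp (Or.inl ⟨φ, ⟨hφ, hK⟩, rfl⟩))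
  refine ⟨_, inferInstance, hid.toHom, ⟨I, U, ⟨Language.Equiv.refl L _⟩⟩, hp.isPecHom ha _ Sum.inl rfl, ?_⟩
  intro m n c q hq hfin
  let t : TupleType L K := ⟨m, n, c, q, hq, hfin⟩
  refine ⟨fun i => a (Sum.inr ⟨t, i⟩), fun φ hφ => ?_⟩
  have := ha _ (hdp (Or.inr ⟨⟨t, φ⟩, hφ, rfl⟩))
  rw [Formula.realize_relabel] at this
  convert this using 1
  funext i
  rcases i with i | i <;> rfl

/-- A positively saturated infinite structure realizes every positive type in `|M|` variables that
is realized in some structure with a smaller positive theory. -/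
theorem IsPositivelySaturated.exists_posLe [Infinite M] (hM : IsPositivelySaturated L M)
    {K : Type u₁} [L.Structure K] {X : Type w} (hX : #X ≤ #M) (a : X → K)
    (hK : PosLe L (default : Empty → K) (default : Empty → M)) : ∃ b : X → M, PosLe L a b := by
  classical
  -- A well-order of initial type: proper initial segments have size < |M|, so saturation applies at
  -- each step.
  obtain ⟨r, hr, hord⟩ := Cardinal.exists_ord_eq X
  let := linearOrderOfSTO r
  have hwf : WellFoundedLT X := ⟨hr.wf⟩
  have hIio (x : X) : #(Set.Iio x) < #M :=
    (card_typein_lt (r := r) x hord).trans_le hX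
  have extend (x : X) (b : Set.Iio x → M) (hb : PosLe L (fun y : Set.Iio x => a y) b) :
      ∃ c : M, PosLe L (Sum.elim (fun y : Set.Iio x => a y) fun _ : Fin 1 => a x)
        (Sum.elim b fun _ => c) := by
    obtain ⟨c, hc⟩ := hM (Set.range b) (Cardinal.mk_range_le.trans_lt (hIio x)) 1
      (Formula.relabel (Sum.map (Set.rangeFactorization b) id) ''
        {φ | IsPositive φ ∧ φ.Realize (Sum.elim (fun y : Set.Iio x => a y) fun _ : Fin 1 => a x)})
      (by rintro _ ⟨φ, hφ, rfl⟩; exact hφ.1.relabel _) (by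
        intro q hq hqf
        obtain ⟨q', hq', hqf', rfl⟩ :=
          Set.exists_subset_image_finite_and (p := (· = q)).1 ⟨q, hq, hqf, rfl⟩
        obtain ⟨c, hc⟩ := hb.exists_realize hqf' (fun φ hφ => (hq' hφ).1)
          ⟨_, fun φ hφ => (hq' hφ).2⟩
        refine ⟨c, ?_⟩
        rintro _ ⟨φ, hφ, rfl⟩
        rw [Formula.realize_relabel, Sum.elim_comp_map]
        exact hc φ hφ)
    refine ⟨c 0, fun φ hφ hφa => ?_⟩
    have := hc _ ⟨φ, ⟨hφ, hφa⟩, rfl⟩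
    rw [Formula.realize_relabel, Sum.elim_comp_map] at this
    have hc0 : (fun _ => c 0) = c := funext fun i => congrArg c (Subsingleton.elim 0 i)
    rw [hc0]
    exact this
  -- The recursion carries no invariant: `epsilon` always returns a value, and its correctness is
  -- proved afterwards by induction.
  let b : X → M := hwf.wf.fix fun x f => Classical.epsilon fun c =>
    PosLe L (Sum.elim (fun y : Set.Iio x => a y) fun _ : Fin 1 => a x)
      (Sum.elim (fun y : Set.Iio x => f y y.2) fun _ => c)
  have hb (x : X) (hx : PosLe L (fun y : Set.Iio x => a y) (fun y : Set.Iio x => b y)) :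
      PosLe L (fun y : Set.Iic x => a y) (fun y : Set.Iic x => b y) := by
    have hbx : b x = Classical.epsilon fun c =>
        PosLe L (Sum.elim (fun y : Set.Iio x => a y) fun _ : Fin 1 => a x)
          (Sum.elim (fun y : Set.Iio x => b y) fun _ => c) := hwf.wf.fix_eq _ _
    have := Classical.epsilon_spec (extend x _ hx)
    rw [← hbx] at this
    have hg := this.comp fun y : Set.Iic x =>
      if hy : y.1 < x then Sum.inl ⟨y.1, hy⟩ else Sum.inr 0
    convert hg using 1
    all_goals
      funext y
      by_cases hy : y.1 < x
      · simp [hy]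
      · simp [le_antisymm y.2 (not_lt.1 hy)]
  have union (S : Set X) (hS : ∀ x ∈ S, PosLe L (fun y : Set.Iic x => a y) (fun y => b y)) :
      PosLe L (fun y : S => a y) (fun y => b y) := by
    refine posLe_of_finite fun n c => ?_
    rcases isEmpty_or_nonempty (Fin n) with hn | hn
    -- The empty tuple lies in no initial segment `Iic x`; here the hypothesis on sentences is used.
    · intro φ hφ hφa
      have := (hK.exists_realize_of_default (q := {φ}) (Set.finite_singleton φ)
        (by simpa using hφ) ⟨_, by simpa using hφa⟩)
      obtain ⟨d, hd⟩ := this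
      rw [Subsingleton.elim (_ ∘ c) d]
      exact hd φ rfl
    · obtain ⟨i, hi⟩ := Finite.exists_max fun i => (c i).1
      exact (hS _ (c i).2).comp fun j => ⟨c j, hi j⟩
  have hIic (x : X) : PosLe L (fun y : Set.Iic x => a y) (fun y => b y) := by
    induction x using hwf.induction with
    | ind x ih => exact hb x (union _ fun y hy => ih y hy)
  exact ⟨b, (union Set.univ fun x _ => hIic x).comp fun x => ⟨x, trivial⟩⟩

/-- For infinite M, p is realized in an ultrapower and the positive type of that realization is
copied into M. -/
theorem IsPositivelySaturated.exists_realize_of_finSat (hM : IsPositivelySaturated L M)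
    {X : Type w} (hX : #X ≤ #M) {p : Set (L.Formula X)} (hpos : ∀ φ ∈ p, IsPositive φ)
    (hp : FinSat M p) : ∃ a : X → M, ∀ φ ∈ p, φ.Realize a := by
  rcases finite_or_infinite M with hfin | hinf
  · have : Finite X := Cardinal.mk_lt_aleph0_iff.1 (hX.trans_lt (Cardinal.mk_lt_aleph0_iff.2 hfin))
    exact exists_realize_of_finite_valuations hp
  · obtain ⟨I, U, a, ha⟩ := hp.exists_ultrapower
    have hU : InPU L M ((U : Filter I).Product fun _ => M) := ⟨I, U, ⟨Language.Equiv.refl L _⟩⟩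
    obtain ⟨b, hb⟩ := hM.exists_posLe hX a (models_thPlus_iff.1 hU.models_thPlus).1
    exact ⟨b, fun φ hφ => hb φ (hpos φ hφ) (ha φ hφ)⟩

theorem IsPositivelySaturated.realizesTypes (hM : IsPositivelySaturated L M) (h : M →[L] M) :
    RealizesTypes h := by
  intro m n a p hp hfin
  suffices ∃ b : Fin n → M, ∀ φ ∈ p, φ.Realize (Sum.elim a b) by
    obtain ⟨b, hb⟩ := this
    exact ⟨h ∘ b, fun φ hφ => by
      rw [← Sum.comp_elim]; exact (hp φ hφ).formula_realize_hom h (hb φ hφ)⟩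
  -- A finite parameter set is smaller than |M| only when M is infinite; otherwise there are
  -- finitely many candidates b.
  rcases finite_or_infinite M with hM' | hM'
  · by_contra! hcon
    choose f hfp hf using hcon
    obtain ⟨b, hb⟩ := hfin (Set.range f) (Set.range_subset_iff.2 hfp) (Set.finite_range f)
    exact hf b (hb _ ⟨b, rfl⟩)
  · have hreal (φ : L.Formula (Fin m ⊕ Fin n)) (b : Fin n → M) :
        (φ.relabel (Sum.map (Set.rangeFactorization a) id)).Realize
          (Sum.elim (fun y : Set.range a => y.1) b) ↔ φ.Realize (Sum.elim a b) := by
      rw [Formula.realize_relabel, Sum.elim_comp_map]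
      rfl
    obtain ⟨b, hb⟩ := hM (Set.range a) ((Set.finite_range a).lt_aleph0.trans_le
      (Cardinal.aleph0_le_mk M)) n (Formula.relabel (Sum.map (Set.rangeFactorization a) id) '' p)
      (by rintro _ ⟨φ, hφ, rfl⟩; exact (hp φ hφ).relabel _) (by
        intro q hq hqf
        obtain ⟨q', hq', hqf', rfl⟩ :=
          Set.exists_subset_image_finite_and (p := (· = q)).1 ⟨q, hq, hqf, rfl⟩
        obtain ⟨b, hb⟩ := hfin q' hq' hqf'
        exact ⟨b, by rintro _ ⟨φ, hφ, rfl⟩; exact (hreal φ b).2 (hb φ hφ)⟩)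
    exact ⟨b, fun φ hφ => (hreal φ b).1 (hb _ ⟨φ, hφ, rfl⟩)⟩

theorem IsPositivelySaturated.exists_isPecHom (hM : IsPositivelySaturated L M) :
    ∃ h : M →[L] M, IsPecHom M h := by
  have hpos : ∀ φ ∈ {φ : L.Formula M | IsPositive φ ∧ φ.Realize id}, IsPositive φ :=
    fun _ hφ => hφ.1
  obtain ⟨p, hdp, hp⟩ := FinSat.exists_isMaximalType (M := M) hpos
    fun q hq _ => ⟨id, fun φ hφ => (hq hφ).2⟩
  obtain ⟨a, ha⟩ := hM.exists_realize_of_finSat le_rfl hp.isPositive hp.finSat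
  have hid : PosLe L (id : M → M) a := fun φ hφ hφa => ha φ (hdp ⟨hφ, hφa⟩)
  exact ⟨hid.toHom, hp.isPecHom ha _ id rfl⟩

end Steps

/-! ### Iteration and conclusion -/

section Main

variable (L : FirstOrder.Language.{u, v}) (M : Type w) [L.Structure M]

theorem exists_inLCPU : ∃ (N : Type (max u v w)) (_ : L.Structure N),
    IsPecModel (thPlus L M) N ∧ IsPositivelySaturatedFor L ℵ₀ N ∧ InLCPU L M N := by
  let S := {K : CategoryTheory.Bundled.{max u v w} L.Structure // InPU L M K}
  have step (K : S) : ∃ (K' : S) (h : K.1 →[L] K'.1), IsPecHom M h ∧ RealizesTypes h := by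
    obtain ⟨K', _, h, hK', hh⟩ := exists_ultrapower_step M K.1 K.2.models_thPlus
    exact ⟨⟨⟨K', inferInstance⟩, hK'⟩, h, hh⟩
  choose next h hpec hreal using step
  -- The ultrapower over one point provides a first stage in the universe `max u v w`.
  let U : Ultrafilter (PUnit.{max u v w + 1}) := pure PUnit.unit
  let start : S := ⟨⟨(U : Filter PUnit).Product fun _ => M, inferInstance⟩, _, U,
    ⟨Language.Equiv.refl L _⟩⟩
  let G : ℕ → S := fun n => Nat.rec start (fun _ => next) n
  let g : ∀ n, (G n).1 →[L] (G (n + 1)).1 := fun n => h (G n)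
  have hG (n : ℕ) : (G n).1 ⊨ thPlus L M := (G n).2.models_thPlus
  exact ⟨(seqChain.{u, v, max u v w, max u v w} g).Limit, inferInstance,
    isPecModel_seqChain_limit hG fun n => hpec (G n),
    isPositivelySaturatedFor_seqChain_limit hG (fun n => hpec (G n)) fun n => hreal (G n),
    seqChain g, fun x => (G x.down).2, ⟨Language.Equiv.refl L _⟩⟩

theorem exists_inLCSelf (hM : IsPositivelySaturated L M) :
    ∃ (N : Type (max u v w)) (_ : L.Structure N),
      IsPecModel (thPlus L M) N ∧ IsPositivelySaturatedFor L ℵ₀ N ∧ InLCSelf L M N := by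
  obtain ⟨h, hpec⟩ := hM.exists_isPecHom
  have hG : M ⊨ thPlus L M := models_thPlus_iff.2 ⟨fun _ _ => id, fun _ _ => id⟩
  exact ⟨(seqChain.{u, v, w, max u v w} (G := fun _ => M) fun _ => h).Limit, inferInstance,
    isPecModel_seqChain_limit (fun _ => hG) fun _ => hpec,
    isPositivelySaturatedFor_seqChain_limit (fun _ => hG) (fun _ => hpec)
      fun _ => hM.realizesTypes h,
    seqChain fun _ => h, fun _ => ⟨Language.Equiv.refl L _⟩, ⟨Language.Equiv.refl L _⟩⟩

end Main

end PositiveLogic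

theorem mainTheorem7 (L : FirstOrder.Language.{u, v}) (M : Type w) [L.Structure M] :
    (∃ (N : Type (max u v w)) (_ : L.Structure N),
      PositiveLogic.IsPecModel (PositiveLogic.thPlus L M) N ∧
      PositiveLogic.IsPositivelySaturatedFor L Cardinal.aleph0 N ∧
      PositiveLogic.InLCPU L M N) ∧
    (PositiveLogic.IsPositivelySaturated L M →
      (Finite M ∨
        Cardinal.lift.{w} L.card ≤ Cardinal.lift.{max u v} (Cardinal.mk M)) →
      ∃ (N : Type (max u v w)) (_ : L.Structure N),
        PositiveLogic.IsPecModel (PositiveLogic.thPlus L M) N ∧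
        PositiveLogic.IsPositivelySaturatedFor L Cardinal.aleph0 N ∧
        PositiveLogic.InLCSelf L M N) :=
  ⟨PositiveLogic.exists_inLCPU L M, fun hM _ => PositiveLogic.exists_inLCSelf L M hM⟩
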